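/- Let $I$ be a set of agents of arbitrary cardinality (finite, countable or uncountable). For each $i\in I$ let $X_i$ be a nonempty compact convex subset of a real Hausdorff topological vector space $E_i$ (neither $E_i$ locally convex nor $X_i$ metrizable is required), and let $X=\prod_{j\in I}X_j$ carry the product topology. Let $\Gamma=(X_i,A_i,P_i)_{i\in I}$ be an abstract economy, that is, for each $i\in I$ let $A_i\colon X\to 2^{X_i}$ (the constraint correspondence) and $P_i\colon X\to 2^{X_i}$ (the preference correspondence) be set-valued maps. Assume that for each $i\in I$: (i) $A_i(x)$ is convex and nonempty for all $x\in X$; (ii) the correspondence $\operatorname{cl}A_i\colon X\to 2^{X_i}$, $x\mapsto\overline{A_i(x)}$ (closure in $X_i$), is upper semicontinuous, i.e. $\{x\in X:\overline{A_i(x)}\subseteq V\}$ is open in $X$ for every open $V\subseteq X_i$; (iii) $A_i$ has open lower sections, i.e. $\{x\in X: y\in A_i(x)\}$ is open in $X$ for every $y\in X_i$; (iv) $P_i$ has open lower sections, i.e. $\{x\in X: y\in P_i(x)\}$ is open in $X$ for every $y\in X_i$; (v) $x_i\notin\operatorname{co}P_i(x)$ for all $x\in X$, where $x_i$ is the $i$-th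 coordinate of $x$ and $\operatorname{co}$ denotes the convex hull. Then $\Gamma$ has an equilibrium: there is an $x^*\in X$ such that $x^*_i\in\overline{A_i(x^*)}$ and $A_i(x^*)\cap P_i(x^*)=\emptyset$ for every $i\in I$. -/

import Mathlib

universe u v

/-- An abstract economy with set of agents `I` and choice sets `X i`: each agent `i` has a
constraint correspondence `A i` and a preference correspondence `P i`, both from the product
of all the choice sets to the subsets of `X i`. -/
structure AbstractEconomy (I : Type u) (X : I → Type v) where
  /-- the constraint correspondences -/
  A : (i : I) → (∀ j, X j) → Set (X i)
  /-- the preference correspondences -/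
  P : (i : I) → (∀ j, X j) → Set (X i)

/-- An equilibrium: `x i` lies in the closure, taken in `X i`, of `A i x`, and
`A i x ∩ P i x = ∅`, for every agent `i`. -/
def AbstractEconomy.IsEquilibrium {I : Type u} {X : I → Type v} [∀ i, TopologicalSpace (X i)]
    (Γ : AbstractEconomy I X) (x : ∀ i, X i) : Prop :=
  ∀ i, x i ∈ closure (Γ.A i x) ∧ Γ.A i x ∩ Γ.P i x = ∅

/-! Put `B i x = A i x` when `x i ∉ closure (A i x)`, and `B i x = A i x ∩ co (P i x)` otherwise.
These values are convex, have open lower sections and never contain `x i`, and any `x` at which all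
of them are empty is an equilibrium.

If there were no such `x`, the open sets `{x | y ∈ B i x}`, over all pairs `(i, y)`, would cover the
compact product. A finite subcover carries one partition of unity, shared by all agents. Its weights
for a single agent may sum to less than one, so that agent moves only by that fraction. Brouwer's
theorem in the finitely many weights (`exists_proportional_on_fibres`) gives a point where every
agent of positive total weight has `x i` as a convex combination of elements of `B i x`, a
contradiction. Only finitely many agents and points enter, so neither local convexity nor
countability matters.

Brouwer's theorem itself comes from Scarf's lemma, a parity argument on dominant sets of lattice
points. -/

/-! ### Scarf's combinatorial lemma. -/

section Scarf

open Finset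

variable {T I α : Type*} [LinearOrder α]

/-- A set `S` of vertices is dominant for the family of orders induced by `ρ` if no vertex
lies strictly above a `ρ i`-smallest element of `S` for every `i`. -/
def Dominant (ρ : I → T ⊕ I → α) (S : Finset (T ⊕ I)) : Prop :=
  ∀ z, ∃ i, ∀ v ∈ S, ρ i z ≤ ρ i v

/-- In a family of injective rankings of `T ⊕ I`, the vertex `inr i` is the smallest for the
`i`-th ranking, and lies above `T` in all the other ones. -/
structure IsScarfFamily (ρ : I → T ⊕ I → α) : Prop where
  injective : ∀ i, Function.Injective (ρ i)
  inr_le : ∀ i v, ρ i (Sum.inr i) ≤ ρ i v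
  lt_inr : ∀ i j t, i ≠ j → ρ i (Sum.inl t) < ρ i (Sum.inr j)

variable {ρ : I → T ⊕ I → α}

theorem Dominant.mono {R S : Finset (T ⊕ I)} (h : Dominant ρ S) (hRS : R ⊆ S) :
    Dominant ρ R := fun z =>
  let ⟨i, hi⟩ := h z
  ⟨i, fun v hv => hi v (hRS hv)⟩

theorem not_dominant_of_forall_inr [Nonempty T] (hρ : IsScarfFamily ρ) {S : Finset (T ⊕ I)}
    (hS : ∀ i, Sum.inr i ∈ S) : ¬ Dominant ρ S := by
  intro h
  obtain ⟨t⟩ := ‹Nonempty T›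
  obtain ⟨i, hi⟩ := h (Sum.inl t)
  have := hρ.injective i (le_antisymm (hi _ (hS i)) (hρ.inr_le i _))
  simp at this

variable [Fintype T] [Fintype I] [DecidableEq T] [DecidableEq I]

/-- If a surjection onto a set with one element less identifies `a ≠ b`, it is injective
on any set that misses `a`. -/
theorem injOn_ne_of_card_succ {β : Type*} [DecidableEq β] {R : Finset β} {m : I → β}
    (hR : R.card + 1 = Fintype.card I) (hm : ∀ v ∈ R, ∃ i, m i = v) {a b : I} (hab : a ≠ b)
    (hmab : m a = m b) : Set.InjOn m ((univ.erase a : Finset I) : Set I) := by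
  have hsub : R ⊆ (univ.erase a).image m := by
    intro v hv
    obtain ⟨i, rfl⟩ := hm v hv
    by_cases hi : i = a
    · subst hi
      exact mem_image.2 ⟨b, by simp [hab.symm], hmab.symm⟩
    · exact mem_image.2 ⟨i, by simp [hi], rfl⟩
  have h1 := card_le_card hsub
  have h2 : (univ.erase a).card = R.card := by
    rw [card_erase_of_mem (mem_univ _), card_univ]; omega
  apply injOn_of_card_image_eq
  exact le_antisymm card_image_le (by omega)

/-- A dominant set with one vertex less than the number of rankings that meets `T` can be
completed to a dominant set by exactly two vertices. -/
theorem exists_pair_dominant_insert_iff (hρ : IsScarfFamily ρ) {R : Finset (T ⊕ I)}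
    (hR : R.card + 1 = Fintype.card I) (hdom : Dominant ρ R) {t₀ : T} (ht₀ : Sum.inl t₀ ∈ R) :
    ∃ p q, p ≠ q ∧ ∀ y, (y ∉ R ∧ Dominant ρ (insert y R)) ↔ (y = p ∨ y = q) := by
  have hm : ∀ i, ∃ v ∈ R, ∀ w ∈ R, ρ i v ≤ ρ i w := fun i =>
    exists_min_image R (ρ i) ⟨_, ht₀⟩
  choose m hmR hmin using hm
  have huniq : ∀ i v, v ∈ R → (∀ w ∈ R, ρ i v ≤ ρ i w) → m i = v := fun i v hv h =>
    hρ.injective i (le_antisymm (hmin i v hv) (h _ (hmR i)))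
  -- Dominance tested at `v` itself makes `v` the minimum of some ranking. As `R` has one element
  -- fewer than `I`, `m` has exactly one coincidence, `m a = m b`; a new vertex must take over index
  -- `a` or index `b`.
  have hsurj : ∀ v ∈ R, ∃ i, m i = v := fun v hv =>
    let ⟨i, hi⟩ := hdom v
    ⟨i, huniq i v hv hi⟩
  obtain ⟨a, -, b, -, hab, hmab⟩ : ∃ a ∈ (univ : Finset I), ∃ b ∈ (univ : Finset I),
      a ≠ b ∧ m a = m b :=
    exists_ne_map_eq_of_card_lt_of_maps_to (t := R) (by rw [card_univ]; omega)
      (fun i _ => hmR i)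
  -- The candidates for the new vertex when `j` is the index it serves.
  let Y : I → Finset (T ⊕ I) := fun j => univ.filter fun y => ∀ i, i ≠ j → ρ i (m i) < ρ i y
  have hYmem : ∀ j y, y ∈ Y j ↔ ∀ i, i ≠ j → ρ i (m i) < ρ i y := fun j y => by simp [Y]
  have hYne : ∀ j, (Y j).Nonempty := fun j => ⟨Sum.inr j, (hYmem _ _).2 fun i hi =>
    (hmin i _ ht₀).trans_lt (hρ.lt_inr i j t₀ hi)⟩
  choose y hyY hymax using fun j => exists_max_image (Y j) (ρ j) (hYne j)
  have hdisj : ∀ i j, i ≠ j → ∀ z, z ∈ Y i → z ∈ Y j → False := by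
    intro i j hij z hzi hzj
    obtain ⟨k, hk⟩ := hdom z
    by_cases hki : k = i
    · subst hki
      exact absurd (hk _ (hmR k)) (not_le.2 ((hYmem _ _).1 hzj k hij))
    · exact absurd (hk _ (hmR k)) (not_le.2 ((hYmem _ _).1 hzi k hki))
  have hgood : ∀ a b, a ≠ b → m a = m b → y a ∉ R ∧ Dominant ρ (insert (y a) R) := by
    intro a b hab hmab
    constructor
    · intro hmem
      obtain ⟨i, hi⟩ := hsurj _ hmem
      have hlt := (hYmem _ _).1 (hyY a)
      by_cases hia : i = a
      · subst hia
        exact (hlt b hab.symm).ne (by rw [← hmab, hi])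
      · exact (hlt i hia).ne (by rw [hi])
    · intro z
      by_cases hz : z ∈ Y a
      · refine ⟨a, fun v hv => ?_⟩
        rcases mem_insert.1 hv with rfl | hvR
        · exact hymax a z hz
        · obtain ⟨k, hk⟩ := hdom z
          by_cases hka : k = a
          · exact hka ▸ hk v hvR
          · exact absurd (hk _ (hmR k)) (not_le.2 ((hYmem _ _).1 hz k hka))
      · rw [hYmem] at hz
        push Not at hz
        obtain ⟨i, hia, hi⟩ := hz
        refine ⟨i, fun v hv => ?_⟩
        rcases mem_insert.1 hv with rfl | hv
        · exact hi.trans ((hYmem _ _).1 (hyY a) i hia).le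
        · exact hi.trans (hmin i v hv)
  refine ⟨y a, y b, fun h => hdisj a b hab (y a) (hyY a) (h ▸ hyY b), fun z => ⟨?_, ?_⟩⟩
  · rintro ⟨hzR, hz⟩
    have hm' : ∀ i, ∃ v ∈ insert z R, ∀ w ∈ insert z R, ρ i v ≤ ρ i w := fun i =>
      exists_min_image _ (ρ i) ⟨z, mem_insert_self _ _⟩
    choose m' hmR' hmin' using hm'
    have hsurj' : ∀ v ∈ insert z R, ∃ i ∈ (univ : Finset I), m' i = v := fun v hv =>
      let ⟨i, hi⟩ := hz v
      ⟨i, mem_univ _, hρ.injective i (le_antisymm (hmin' i v hv) (hi _ (hmR' i)))⟩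
    -- In the enlarged set vertices and rankings match bijectively, so `z` serves a single index `j`
    -- and all other minima are unchanged.
    have hinj' : ∀ i k, m' i = m' k → i = k := by
      have hcard : (univ : Finset I).card ≤ (insert z R).card := by
        rw [card_insert_of_notMem hzR, hR, card_univ]
      intro i k h
      exact inj_on_of_surj_on_of_card_le (fun i _ => m' i) (fun i _ => hmR' i)
        (fun v hv => let ⟨i, hi, h⟩ := hsurj' v hv; ⟨i, hi, h⟩) hcard (mem_univ i) (mem_univ k) h
    obtain ⟨j, -, hj⟩ := hsurj' z (mem_insert_self _ _)
    have hmm : ∀ i, i ≠ j → m i = m' i := fun i hi => by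
      refine huniq i _ ?_ fun w hw => hmin' i w (mem_insert_of_mem hw)
      exact (mem_insert.1 (hmR' i)).resolve_left fun h => hi (hinj' _ _ (h.trans hj.symm))
    have hzY : z ∈ Y j := (hYmem _ _).2 fun i hi => by
      rw [hmm i hi]
      refine lt_of_le_of_ne (hmin' i z (mem_insert_self _ _)) fun h => hi (hinj' _ _ ?_)
      rw [hj]; exact hρ.injective i h
    have hzy : z = y j := by
      apply hρ.injective j
      refine le_antisymm (hymax j z hzY) ?_
      obtain ⟨i, hi⟩ := hz (y j)
      by_cases hij : i = j
      · subst hij; exact hi z (mem_insert_self _ _)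
      · exact absurd (hi _ (mem_insert_of_mem (hmR i)))
          (not_le.2 ((hYmem _ _).1 (hyY j) i hij))
    by_cases hja : j = a
    · left; rw [hzy, hja]
    by_cases hjb : j = b
    · right; rw [hzy, hjb]
    · refine absurd (hinj' a b ?_) hab
      rw [← hmm a (Ne.symm hja), ← hmm b (Ne.symm hjb), hmab]
  · rintro (rfl | rfl)
    · exact hgood a b hab hmab
    · exact hgood b a hab.symm hmab.symm

/-- The boundary set of all `inr i` with `i ≠ j` is completed to a dominant set by exactly
one vertex. -/
theorem existsUnique_dominant_insert_boundary [Nonempty T] (hρ : IsScarfFamily ρ) (j : I) :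
    ∃! y, y ∉ (univ.erase j).image (Sum.inr : I → T ⊕ I) ∧
      Dominant ρ (insert y ((univ.erase j).image Sum.inr)) := by
  obtain ⟨t, -, ht⟩ := exists_max_image (univ : Finset T) (fun t => ρ j (Sum.inl t))
    univ_nonempty
  -- For `i ≠ j` the set contains `inr i`, the bottom of ranking `i`, so only ranking `j` can bound
  -- an element of `T`. Hence the added vertex is the `ρ j`-largest element of `T`.
  have hi : ∀ (i : I) (z : T) (y : T ⊕ I),
      (∀ v ∈ insert y ((univ.erase j).image Sum.inr), ρ i (Sum.inl z) ≤ ρ i v) → i = j := by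
    intro i z y h
    by_contra hij
    have := hρ.injective i (le_antisymm
      (h (Sum.inr i) (by simp [hij])) (hρ.inr_le i _))
    simp at this
  refine ⟨Sum.inl t, ⟨by simp, ?_⟩, ?_⟩
  · rintro (z | k)
    · refine ⟨j, fun v hv => ?_⟩
      rcases mem_insert.1 hv with rfl | hv
      · exact ht z (mem_univ _)
      · obtain ⟨k, hk, rfl⟩ := mem_image.1 hv
        exact (hρ.lt_inr j k z (by simpa [eq_comm] using hk)).le
    · exact ⟨k, fun v _ => hρ.inr_le k v⟩
  · rintro (s | k) ⟨hy, hdom⟩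
    · obtain ⟨i, h⟩ := hdom (Sum.inl t)
      obtain rfl : i = j := hi i t (Sum.inl s) h
      have := h _ (mem_insert_self _ _)
      exact hρ.injective i (le_antisymm (ht s (mem_univ _)) this)
    · refine absurd hdom (not_dominant_of_forall_inr hρ fun i => ?_)
      have hk : k = j := by
        by_contra hkj
        exact hy (mem_image_of_mem _ (mem_erase.2 ⟨hkj, mem_univ _⟩))
      by_cases hij : i = j
      · simp [hij, hk]
      · simp [hij]

/-- The number of ways of removing a vertex so as to keep exactly the colours other than `j₀`
is odd precisely for the rainbow sets. -/
theorem odd_card_filter_image_erase {V : Type*} [DecidableEq V] (c : V → I) (j₀ : I)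
    {S : Finset V} (hS : S.card = Fintype.card I) :
    Odd (S.filter fun x => (S.erase x).image c = univ.erase j₀).card ↔ S.image c = univ := by
  have hinj : ∀ x ∈ S, (S.erase x).image c = univ.erase j₀ →
      Set.InjOn c ((S.erase x : Finset V) : Set V) := by
    intro x hx h
    apply injOn_of_card_image_eq
    rw [h, card_erase_of_mem (mem_univ _), card_erase_of_mem hx, hS, card_univ]
  by_cases hrain : S.image c = univ
  · simp only [hrain, iff_true]
    have hc : Set.InjOn c (S : Set V) := by
      apply injOn_of_card_image_eq
      rw [hrain, hS, card_univ]
    obtain ⟨x, hx, hxj⟩ := mem_image.1 (hrain ▸ mem_univ j₀ : j₀ ∈ S.image c)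
    have : (S.filter fun x => (S.erase x).image c = univ.erase j₀) = {x} := by
      ext z
      simp only [mem_filter, mem_singleton]
      constructor
      · rintro ⟨hz, h⟩
        by_contra hne
        have : j₀ ∈ (S.erase z).image c :=
          mem_image.2 ⟨x, mem_erase.2 ⟨Ne.symm hne, hx⟩, hxj⟩
        rw [h] at this
        exact notMem_erase _ _ this
      · rintro rfl
        refine ⟨hx, ?_⟩
        ext k
        simp only [mem_image, mem_erase, mem_univ, and_true]
        constructor
        · rintro ⟨w, ⟨hwz, hw⟩, rfl⟩ h
          exact hwz (hc hw hx (h.trans hxj.symm))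
        · intro hk
          obtain ⟨w, hw, rfl⟩ := mem_image.1 (hrain ▸ mem_univ k : k ∈ S.image c)
          exact ⟨w, ⟨fun h => hk (h ▸ hxj), hw⟩, rfl⟩
    simp [this]
  · simp only [hrain, iff_false, Nat.not_odd_iff_even]
    by_cases hne : (S.filter fun x => (S.erase x).image c = univ.erase j₀).Nonempty
    · obtain ⟨x, hx⟩ := hne
      obtain ⟨hxS, hx⟩ := mem_filter.1 hx
      have hcx : c x ≠ j₀ := by
        intro h
        apply hrain
        rw [← insert_erase hxS, image_insert, hx, h, insert_erase (mem_univ _)]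
      -- The colour of `x` survives its removal, so it is shared by some `x'`; the removable
      -- vertices are exactly these two.
      obtain ⟨x', hx', hcx'⟩ := mem_image.1
        (hx ▸ mem_erase.2 ⟨hcx, mem_univ _⟩ : c x ∈ (S.erase x).image c)
      have hx'S := mem_of_mem_erase hx'
      have hxx' : x' ≠ x := ne_of_mem_erase hx'
      have : (S.filter fun x => (S.erase x).image c = univ.erase j₀) = {x, x'} := by
        ext z
        simp only [mem_filter, mem_insert, mem_singleton]
        constructor
        · rintro ⟨hz, h⟩
          by_contra! hne
          exact hxx' (hinj z hz h (by simp [hx'S, Ne.symm hne.2])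
            (by simp [hxS, Ne.symm hne.1]) hcx')
        · rintro (rfl | rfl)
          · exact ⟨hxS, hx⟩
          · refine ⟨hx'S, ?_⟩
            rw [← hx]
            ext k
            simp only [mem_image, mem_erase]
            constructor
            · rintro ⟨w, ⟨hw1, hw2⟩, rfl⟩
              by_cases hwx : w = x
              · exact ⟨z, ⟨hxx', hx'S⟩, by rw [hcx', hwx]⟩
              · exact ⟨w, ⟨hwx, hw2⟩, rfl⟩
            · rintro ⟨w, ⟨hw1, hw2⟩, rfl⟩
              by_cases hwx : w = z
              · exact ⟨x, ⟨hxx'.symm, hxS⟩, by rw [hwx, hcx']⟩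
              · exact ⟨w, ⟨hwx, hw2⟩, rfl⟩
      rw [this, card_pair hxx'.symm]
      exact even_two
    · rw [not_nonempty_iff_eq_empty.1 hne]
      simp

open Classical in
/-- Scarf's combinatorial lemma: a colouring of the vertices in which `inr i` has colour `i`
admits a dominant rainbow set. -/
theorem IsScarfFamily.exists_rainbow [Nonempty T] [Nonempty I] (hρ : IsScarfFamily ρ)
    (c : T ⊕ I → I) (hc : ∀ i, c (Sum.inr i) = i) :
    ∃ S : Finset (T ⊕ I), Dominant ρ S ∧ S.image c = univ := by
  obtain ⟨j₀⟩ := ‹Nonempty I›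
  by_contra! hno
  let F : Finset (Finset (T ⊕ I)) :=
    univ.filter fun S => S.card = Fintype.card I ∧ Dominant ρ S
  let D : Finset (Finset (T ⊕ I)) := univ.filter fun R => R.card + 1 = Fintype.card I ∧
    Dominant ρ R ∧ R.image c = univ.erase j₀
  let B : Finset (T ⊕ I) := (univ.erase j₀).image Sum.inr
  have hcardB : B.card + 1 = Fintype.card I := by
    rw [card_image_of_injective _ Sum.inr_injective, card_erase_add_one (mem_univ _), card_univ]
  have hBD : B ∈ D := by
    refine mem_filter.2 ⟨mem_univ _, hcardB, ?_, ?_⟩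
    · obtain ⟨y, ⟨-, hy⟩, -⟩ := existsUnique_dominant_insert_boundary hρ j₀
      exact hy.mono (subset_insert _ _)
    · rw [image_image]
      rw [show c ∘ Sum.inr = id from funext hc, image_id]
  -- Double counting of the inclusions `R ⊆ S`: without rainbow sets every `S` contributes an even
  -- number, while every `R` contributes two except `B`, which contributes one.
  have key : ∑ S ∈ F, (D.filter fun R => R ⊆ S).card
      = ∑ R ∈ D, (F.filter fun S => R ⊆ S).card := by
    simp only [card_filter]
    exact sum_comm
  have hF : ∀ S ∈ F, Even (D.filter fun R => R ⊆ S).card := by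
    intro S hS
    obtain ⟨-, hcard, hdom⟩ := mem_filter.1 hS
    have := (odd_card_filter_image_erase c j₀ hcard).not.2 (hno S hdom)
    rw [Nat.not_odd_iff_even] at this
    convert this using 1
    symm
    refine card_bij (fun x _ => S.erase x) ?_ ?_ ?_
    · intro x hx
      obtain ⟨hxS, hx⟩ := mem_filter.1 hx
      refine mem_filter.2 ⟨mem_filter.2 ⟨mem_univ _, ?_, hdom.mono (erase_subset _ _), hx⟩,
        erase_subset _ _⟩
      rw [card_erase_add_one hxS, hcard]
    · intro x hx x' hx' h
      exact erase_injOn S (mem_filter.1 hx).1 (mem_filter.1 hx').1 h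
    · intro R hR
      obtain ⟨hR, hRS⟩ := mem_filter.1 hR
      obtain ⟨-, hRcard, -, hRc⟩ := mem_filter.1 hR
      obtain ⟨x, hxR, rfl⟩ : ∃ x, x ∉ R ∧ insert x R = S :=
        (covBy_iff_exists_insert.1 (covBy_iff_card_sdiff_eq_one.2
          ⟨hRS, by rw [card_sdiff_of_subset hRS]; omega⟩))
      exact ⟨x, mem_filter.2 ⟨mem_insert_self _ _, by rwa [erase_insert hxR]⟩, erase_insert hxR⟩
  have hDcard : ∀ R ∈ D, (F.filter fun S => R ⊆ S).card =
      (univ.filter fun y => y ∉ R ∧ Dominant ρ (insert y R)).card := by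
    intro R hR
    obtain ⟨-, hRcard, -, -⟩ := mem_filter.1 hR
    symm
    refine card_bij (fun y _ => insert y R) ?_ ?_ ?_
    · intro y hy
      obtain ⟨-, hyR, hy⟩ := mem_filter.1 hy
      exact mem_filter.2 ⟨mem_filter.2 ⟨mem_univ _, by rw [card_insert_of_notMem hyR, hRcard], hy⟩,
        subset_insert _ _⟩
    · intro y hy y' hy' h
      exact (insert_inj (mem_filter.1 hy).2.1).1 h
    · intro S hS
      obtain ⟨hS, hRS⟩ := mem_filter.1 hS
      obtain ⟨-, hcard, hdom⟩ := mem_filter.1 hS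
      obtain ⟨x, hxR, rfl⟩ : ∃ x, x ∉ R ∧ insert x R = S :=
        (covBy_iff_exists_insert.1 (covBy_iff_card_sdiff_eq_one.2
          ⟨hRS, by rw [card_sdiff_of_subset hRS]; omega⟩))
      exact ⟨x, mem_filter.2 ⟨mem_univ _, hxR, hdom⟩, rfl⟩
  have hB : (F.filter fun S => B ⊆ S).card = 1 := by
    rw [hDcard B hBD, card_eq_one]
    obtain ⟨y, hy, huniq⟩ := existsUnique_dominant_insert_boundary hρ j₀
    refine ⟨y, ?_⟩
    ext z
    simp only [mem_filter, mem_univ, true_and, mem_singleton]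
    exact ⟨fun h => huniq z h, fun h => h ▸ hy⟩
  have hD : ∀ R ∈ D.erase B, Even (F.filter fun S => R ⊆ S).card := by
    intro R hR
    obtain ⟨hRB, hRD⟩ := mem_erase.1 hR
    rw [hDcard R hRD]
    obtain ⟨-, hRcard, hRdom, hRc⟩ := mem_filter.1 hRD
    obtain ⟨t₀, ht₀⟩ : ∃ t, Sum.inl t ∈ R := by
      by_contra! hinl
      apply hRB
      refine eq_of_subset_of_card_le ?_ (by omega)
      rintro (t | i) hv
      · exact absurd hv (hinl t)
      · have : i ∈ R.image c := mem_image.2 ⟨_, hv, hc i⟩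
        rw [hRc] at this
        exact mem_image_of_mem _ this
    obtain ⟨p, q, hpq, h⟩ := exists_pair_dominant_insert_iff hρ hRcard hRdom ht₀
    have : (univ.filter fun y => y ∉ R ∧ Dominant ρ (insert y R)) = {p, q} := by
      ext y; simp [h y]
    rw [this, card_pair hpq]
    exact even_two
  rw [← add_sum_erase _ _ hBD, hB] at key
  have h1 := even_sum _ hF
  have h2 := even_sum _ hD
  rw [key, Nat.even_add] at h1
  exact Nat.not_even_one (h1.2 h2)

end Scarf

/-! ### Brouwer's theorem on the standard simplex. -/

section Brouwer

open Finset

/-- Scarf's lemma for the points of `ℕ^I` with coordinate sum `m`: any colouring by `I` admits a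
cluster `S` of such points showing all the colours of some `C`, on which the coordinates outside
`C` are small. -/
theorem exists_rainbow_cluster {I : Type*} [Fintype I] [DecidableEq I] [Nonempty I] (m : ℕ)
    (c : (I → ℕ) → I) :
    ∃ (S : Finset (I → ℕ)) (C : Finset I), S.Nonempty ∧ (∀ x ∈ S, ∑ i, x i = m) ∧
      (∀ i ∈ C, ∃ x ∈ S, c x = i) ∧ (∀ x ∈ S, ∀ y ∈ S, ∀ i, x i ≤ y i + Fintype.card I) ∧
      ∀ x ∈ S, ∀ i ∉ C, x i ≤ Fintype.card I := by
  classical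
  let T := {x : I → ℕ // x ∈ (univ : Finset I).piAntidiag m}
  have hT : ∀ x : I → ℕ, x ∈ (univ : Finset I).piAntidiag m ↔ ∑ i, x i = m := fun x => by
    simp [mem_piAntidiag]
  have hTne : Nonempty T := by
    obtain ⟨i⟩ := ‹Nonempty I›
    exact ⟨⟨Pi.single i m, (hT _).2 (by simp)⟩⟩
  let e := Fintype.equivFin (T ⊕ I)
  -- Coordinates of lattice points, shifted by one, lie in `[1, m + 1]`, strictly between the values
  -- 0 and `m + 2` given to the `inr` vertices. The enumeration `e` breaks ties in `ρ`.
  let h : I → T ⊕ I → ℕ := fun i => Sum.elim (fun x => x.1 i + 1) fun j => if i = j then 0 else m + 2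
  let ρ : I → T ⊕ I → ℕ ×ₗ ℕ := fun i v => toLex (h i v, (e v : ℕ))
  have hle : ∀ {i v w}, ρ i v ≤ ρ i w → h i v ≤ h i w := fun {i v w} hvw => by
    rcases Prod.Lex.le_iff.1 hvw with h1 | h1
    · exact le_of_lt h1
    · exact le_of_eq h1.1
  have hlt : ∀ {i v w}, h i v < h i w → ρ i v < ρ i w := fun {i v w} hvw =>
    Prod.Lex.lt_iff.2 (Or.inl hvw)
  have hρ : IsScarfFamily ρ := by
    refine ⟨fun i v w hvw => ?_, fun i v => ?_, fun i j t hij => hlt ?_⟩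
    · have h1 := congrArg (fun p => (ofLex p).2) hvw
      exact e.injective (Fin.ext h1)
    · rcases v with x | j
      · exact (hlt (by simp [h])).le
      · by_cases hij : i = j
        · rw [hij]
        · exact (hlt (by simp [h, hij])).le
    · have h1 : t.1 i ≤ ∑ k, t.1 k := single_le_sum (fun _ _ => Nat.zero_le _) (mem_univ i)
      rw [(hT _).1 t.2] at h1
      simp [h, hij]
      omega
  obtain ⟨S, hdom, hS⟩ := hρ.exists_rainbow (Sum.elim (fun x => c x.1) id) fun i => rfl
  let S' : Finset (I → ℕ) := ((univ : Finset T).filter fun x => Sum.inl x ∈ S).image Subtype.val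
  let C : Finset I := univ.filter fun i => Sum.inr i ∉ S
  have hS' : ∀ x, x ∈ S' ↔ ∃ hx : x ∈ (univ : Finset I).piAntidiag m, Sum.inl ⟨x, hx⟩ ∈ S :=
    fun x => by simp [S', T]
  have hsum : ∀ x ∈ S', ∑ i, x i = m := fun x hx => (hT x).1 ((hS' x).1 hx).1
  have hcol : ∀ i ∈ C, ∃ x ∈ S', c x = i := by
    intro i hi
    obtain ⟨x | j, hv, hvi⟩ := mem_image.1 (hS ▸ mem_univ i)
    · exact ⟨x.1, (hS' _).2 ⟨x.2, hv⟩, hvi⟩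
    · obtain rfl : j = i := hvi
      exact absurd hv (mem_filter.1 hi).2
  have hdomS : ∀ t : I → ℕ, ∑ i, t i = m → ∃ i ∈ C, ∀ x ∈ S', t i ≤ x i := by
    intro t ht
    obtain ⟨i, hi⟩ := hdom (Sum.inl ⟨t, (hT t).2 ht⟩)
    refine ⟨i, mem_filter.2 ⟨mem_univ _, fun hmem => ?_⟩, fun x hx => ?_⟩
    · have := hle (hi _ hmem)
      simp [h] at this
    · obtain ⟨hx, hxS⟩ := (hS' x).1 hx
      have := hle (hi _ hxS)
      simpa [h] using this
  have hCne : C.Nonempty := by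
    obtain ⟨t⟩ := hTne
    obtain ⟨i, hi, -⟩ := hdomS t.1 ((hT _).1 t.2)
    exact ⟨i, hi⟩
  have hSne : S'.Nonempty := by
    obtain ⟨i, hi⟩ := hCne
    obtain ⟨x, hx, -⟩ := hcol i hi
    exact ⟨x, hx⟩
  choose lo hloS hlo using fun i => exists_min_image S' (fun x => x i) hSne
  -- Otherwise `lo i i + 1` on `C`, with the surplus mass put on `i₀`, is a lattice point exceeding
  -- all the minima, against dominance. So the minima on `C` leave less than `C.card` of the mass
  -- `m` free, which bounds both the spread on `C` and the mass outside it.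
  have hbig : m < ∑ i ∈ C, (lo i i + 1) := by
    by_contra! hle
    obtain ⟨i₀, hi₀⟩ := hCne
    let t : I → ℕ := fun i => (if i ∈ C then lo i i + 1 else 0) +
      if i = i₀ then m - ∑ i ∈ C, (lo i i + 1) else 0
    have ht : ∑ i, t i = m := by
      simp only [t, sum_add_distrib, sum_ite_mem, univ_inter, sum_ite_eq', mem_univ, if_true]
      simp only [sum_add_distrib] at hle ⊢
      omega
    obtain ⟨i, hi, h1⟩ := hdomS t ht
    have := h1 _ (hloS i)
    simp only [t, hi, if_true] at this
    omega
  have hcard : C.card ≤ Fintype.card I := card_le_univ C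
  rw [sum_add_distrib, sum_const, smul_eq_mul, mul_one] at hbig
  have hsplit : ∀ x ∈ S', ∑ i ∈ C, (x i - lo i i) + ∑ i ∈ Cᶜ, x i < Fintype.card I := by
    intro x hx
    have h1 : ∑ i ∈ C, (x i - lo i i) + ∑ i ∈ C, lo i i = ∑ i ∈ C, x i := by
      rw [← sum_add_distrib]
      exact sum_congr rfl fun i _ => Nat.sub_add_cancel (hlo i x hx)
    have h2 := sum_add_sum_compl C x
    rw [hsum x hx] at h2
    omega
  have hout : ∀ x ∈ S', ∀ i ∉ C, x i ≤ Fintype.card I := by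
    intro x hx i hi
    have h1 : x i ≤ ∑ i ∈ Cᶜ, x i :=
      single_le_sum (fun _ _ => Nat.zero_le _) (mem_compl.2 hi)
    have := hsplit x hx
    omega
  refine ⟨S', C, hSne, hsum, hcol, fun x hx y hy i => ?_, hout⟩
  by_cases hi : i ∈ C
  · have h1 : x i - lo i i ≤ ∑ i ∈ C, (x i - lo i i) :=
      single_le_sum (f := fun i => x i - lo i i) (fun _ _ => Nat.zero_le _) hi
    have h2 := hsplit x hx
    have h3 := hlo i y hy
    omega
  · exact (hout x hx i hi).trans (Nat.le_add_left _ _)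

/-- A continuous self-map of the standard simplex almost increases all the coordinates
at some point. -/
theorem exists_forall_le_add_of_continuous_stdSimplex {I : Type*} [Fintype I] [Nonempty I]
    {f : stdSimplex ℝ I → stdSimplex ℝ I} (hf : Continuous f) {ε : ℝ} (hε : 0 < ε) :
    ∃ p : stdSimplex ℝ I, ∀ i, p.1 i ≤ (f p).1 i + ε := by
  classical
  have hcpt : CompactSpace (stdSimplex ℝ I) :=
    isCompact_iff_compactSpace.1 (isCompact_stdSimplex ℝ I)
  obtain ⟨δ, hδ, hfδ⟩ := Metric.uniformContinuous_iff.1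
    (CompactSpace.uniformContinuous_of_continuous hf) (ε / 2) (half_pos hε)
  obtain ⟨n, hn⟩ : ∃ n : ℝ, n = Fintype.card I := ⟨_, rfl⟩
  have hn0 : 0 < n := hn ▸ Nat.cast_pos.2 Fintype.card_pos
  obtain ⟨m, hm⟩ := exists_nat_gt (n / min δ (ε / 2))
  have hmin : 0 < min δ (ε / 2) := lt_min hδ (half_pos hε)
  have hm0 : (0 : ℝ) < m := (div_pos hn0 hmin).trans hm
  have hnm : n / m < min δ (ε / 2) := by
    rw [div_lt_iff₀ hm0]
    rw [div_lt_iff₀ hmin] at hm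
    linarith
  -- Rescaling of the integer points, with a default value on those of the wrong mass.
  let q : (I → ℕ) → stdSimplex ℝ I := fun x => if hx : ∑ i, x i = m then
    ⟨fun i => x i / m, fun i => by positivity, by
      rw [← sum_div, ← Nat.cast_sum, hx, div_self hm0.ne']⟩ else Classical.arbitrary _
  have hq : ∀ x, ∑ i, x i = m → ∀ i, (q x).1 i = x i / m := fun x hx i => by
    simp only [q, dif_pos hx]
  -- Equal coordinate sums prevent `f` from decreasing every coordinate; a non-decreased one serves
  -- as the colour.
  have hc : ∀ p : stdSimplex ℝ I, ∃ i, p.1 i ≤ (f p).1 i := by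
    intro p
    obtain ⟨i, -, hi⟩ := exists_le_of_sum_le (s := (univ : Finset I)) univ_nonempty
      (f := p.1) (g := (f p).1) (p.2.2.trans (f p).2.2.symm).le
    exact ⟨i, hi⟩
  choose c hc using hc
  obtain ⟨S, C, ⟨x, hx⟩, hsum, hcol, hclose, hout⟩ := exists_rainbow_cluster m fun x => c (q x)
  refine ⟨q x, fun i => ?_⟩
  by_cases hi : i ∈ C
  · obtain ⟨y, hy, rfl⟩ := hcol i hi
    have hdist : ∀ j, |(q x).1 j - (q y).1 j| ≤ n / m := by
      intro j
      rw [hq x (hsum x hx), hq y (hsum y hy), ← sub_div, abs_div, abs_of_pos hm0]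
      gcongr
      have h1 : (x j : ℝ) ≤ y j + n := by rw [hn]; exact_mod_cast hclose x hx y hy j
      have h2 : (y j : ℝ) ≤ x j + n := by rw [hn]; exact_mod_cast hclose y hy x hx j
      rw [abs_le]
      constructor <;> linarith
    have hd : dist (q x) (q y) < δ := by
      rw [Subtype.dist_eq]
      refine lt_of_le_of_lt ((dist_pi_le_iff (by positivity)).2 hdist)
        (hnm.trans_le (min_le_left _ _))
    have h1 := hfδ hd
    rw [Subtype.dist_eq] at h1
    have h2 := (dist_le_pi_dist (f (q x)).1 (f (q y)).1 (c (q y))).trans_lt h1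
    rw [Real.dist_eq, abs_lt] at h2
    have h3 := hc (q y)
    have h4 := (abs_le.1 (hdist (c (q y)))).2
    have h5 := min_le_right δ (ε / 2)
    linarith [h2.1]
  · rw [hq x (hsum x hx)]
    have h1 : (x i : ℝ) ≤ n := by rw [hn]; exact_mod_cast hout x hx i hi
    have h2 : (x i : ℝ) / m ≤ n / m := by gcongr
    have h3 := min_le_right δ (ε / 2)
    have h4 : 0 ≤ (f (q x)).1 i := (f (q x)).2.1 i
    linarith

/-- **Brouwer's fixed point theorem** for the standard simplex. -/
theorem exists_fixedPoint_stdSimplex {I : Type*} [Fintype I] [Nonempty I]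
    {f : stdSimplex ℝ I → stdSimplex ℝ I} (hf : Continuous f) : ∃ p, f p = p := by
  classical
  have hcpt : CompactSpace (stdSimplex ℝ I) :=
    isCompact_iff_compactSpace.1 (isCompact_stdSimplex ℝ I)
  let g : stdSimplex ℝ I → ℝ := fun p =>
    univ.sup' univ_nonempty fun i => p.1 i - (f p).1 i
  have hg : Continuous g := by
    refine Continuous.finset_sup'_apply _ fun i _ => ?_
    have h1 : Continuous fun p : stdSimplex ℝ I => p.1 i :=
      (continuous_apply i).comp continuous_subtype_val
    exact h1.sub (h1.comp hf)
  obtain ⟨p, -, hp⟩ := isCompact_univ.exists_isMinOn Set.univ_nonempty hg.continuousOn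
  have hp0 : g p ≤ 0 := by
    refine le_of_forall_pos_le_add fun ε hε => ?_
    obtain ⟨q, hq⟩ := exists_forall_le_add_of_continuous_stdSimplex hf hε
    have h1 : g p ≤ g q := hp (Set.mem_univ q)
    refine h1.trans (sup'_le _ _ fun i _ => ?_)
    linarith [hq i]
  have hle : ∀ i ∈ (univ : Finset I), p.1 i ≤ (f p).1 i := fun i hi => by
    have := (le_sup' (fun i => p.1 i - (f p).1 i) hi).trans hp0
    linarith
  refine ⟨p, Subtype.ext (funext fun i => ?_)⟩
  exact (((sum_eq_sum_iff_of_le hle).1 (p.2.2.trans (f p).2.2.symm)) i (mem_univ i)).symm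

end Brouwer

/-! ### Common maximal elements on a product of compact convex sets. -/

open Finset in
/-- Brouwer's theorem on a product of simplices `{u ≥ 0 | ∑ u ≤ 1}` indexed by the fibres
of `a`, for the map replacing a fraction of `u` by prescribed weights `f`: at a fixed point
these weights are proportional to `u` on each fibre. -/
theorem exists_proportional_on_fibres {K I : Type*} [Fintype K] [DecidableEq I] (a : K → I)
    (f : K → {u : K → ℝ // (∀ k, 0 ≤ u k) ∧ ∀ i, ∑ k with a k = i, u k ≤ 1} → ℝ)
    (hf : ∀ k, Continuous (f k)) (hf0 : ∀ k u, 0 ≤ f k u) (hf1 : ∀ u, ∑ k, f k u ≤ 1) :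
    ∃ u, ∀ k, f k u = (∑ l with a l = a k, f l u) * u.1 k := by
  classical
  rcases isEmpty_or_nonempty K with hK | hK
  · exact ⟨⟨0, by simp⟩, fun k => isEmptyElim k⟩
  obtain ⟨N, hNK⟩ : ∃ N : ℝ, N = Fintype.card K := ⟨_, rfl⟩
  have hN : 0 < N := hNK ▸ Nat.cast_pos.2 Fintype.card_pos
  let M : (K → ℝ) → I → ℝ := fun t i => max 1 (∑ l with a l = i, t l)
  have hM : ∀ t i, 0 < M t i := fun t i => zero_lt_one.trans_le (le_max_left _ _)
  -- After scaling by `N`, each fibre of mass above one is shrunk radially to mass one. The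
  -- coordinate `none` holds the slack.
  let r : stdSimplex ℝ (Option K) →
      {u : K → ℝ // (∀ k, 0 ≤ u k) ∧ ∀ i, ∑ k with a k = i, u k ≤ 1} := fun p =>
    ⟨fun k => N * p.1 (some k) / M (fun l => N * p.1 (some l)) (a k),
      fun k => div_nonneg (mul_nonneg hN.le (p.2.1 _)) (hM _ _).le, fun i => by
        have h1 : ∀ k ∈ (univ.filter fun k => a k = i),
            N * p.1 (some k) / M (fun l => N * p.1 (some l)) (a k)
              = N * p.1 (some k) / M (fun l => N * p.1 (some l)) i := fun k hk => by
          rw [(mem_filter.1 hk).2]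
        rw [sum_congr rfl h1, ← sum_div, div_le_one (hM _ _)]
        exact le_max_right _ _⟩
  have hr : Continuous r := by
    refine Continuous.subtype_mk (continuous_pi fun k => ?_) _
    have h1 : ∀ k, Continuous fun p : stdSimplex ℝ (Option K) => N * p.1 (some k) := fun k =>
      continuous_const.mul ((continuous_apply _).comp continuous_subtype_val)
    exact (h1 k).div (continuous_const.max (continuous_finsetSum _ fun l _ => h1 l))
      fun p => (hM _ _).ne'
  -- `G u = u` is the desired proportionality. Each `G k u ≤ 1`, so dividing by `N` fits `G` into
  -- the simplex.
  let G : K → {u : K → ℝ // (∀ k, 0 ≤ u k) ∧ ∀ i, ∑ k with a k = i, u k ≤ 1} → ℝ := fun k u =>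
    f k u + (1 - ∑ l with a l = a k, f l u) * u.1 k
  have hs1 : ∀ u i, ∑ l with a l = i, f l u ≤ 1 := fun u i =>
    (sum_le_univ_sum_of_nonneg fun k => hf0 k u).trans (hf1 u)
  have hG0 : ∀ k u, 0 ≤ G k u := fun k u =>
    add_nonneg (hf0 k u) (mul_nonneg (sub_nonneg.2 (hs1 u _)) (u.2.1 k))
  have hG1 : ∀ k u, G k u ≤ 1 := fun k u => by
    have hk : k ∈ univ.filter fun l => a l = a k := by simp
    have h1 : f k u ≤ ∑ l with a l = a k, f l u :=
      single_le_sum (f := fun l => f l u) (fun l _ => hf0 l u) hk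
    have h2 : u.1 k ≤ 1 := (single_le_sum (fun l _ => u.2.1 l) hk).trans (u.2.2 (a k))
    have h3 := mul_le_mul_of_nonneg_left h2 (sub_nonneg.2 (hs1 u (a k)))
    simp only [G]
    linarith
  have hG : ∀ k, Continuous (G k) := fun k =>
    (hf k).add ((continuous_const.sub (continuous_finsetSum _ fun l _ => hf l)).mul
      ((continuous_apply k).comp continuous_subtype_val))
  have hGN : ∀ u, ∑ k, G k u / N ≤ 1 := fun u => by
    rw [← sum_div, div_le_one hN]
    exact (sum_le_sum fun k _ => hG1 k u).trans (by simp [hNK])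
  let g : stdSimplex ℝ (Option K) → stdSimplex ℝ (Option K) := fun p =>
    ⟨fun o => o.elim (1 - ∑ k, G k (r p) / N) fun k => G k (r p) / N, fun o => by
      rcases o with _ | k
      · exact sub_nonneg.2 (hGN _)
      · exact div_nonneg (hG0 _ _) hN.le, by
      rw [Fintype.sum_option]
      simp⟩
  have hg : Continuous g := by
    refine Continuous.subtype_mk (continuous_pi fun o => ?_) _
    have h1 : ∀ k, Continuous fun p => G k (r p) / N := fun k => ((hG k).comp hr).div_const N
    rcases o with _ | k
    · exact continuous_const.sub (continuous_finsetSum _ fun k _ => h1 k)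
    · exact h1 k
  obtain ⟨p, hp⟩ := exists_fixedPoint_stdSimplex hg
  have ht : ∀ k, N * p.1 (some k) = G k (r p) := fun k => by
    have h1 : G k (r p) / N = p.1 (some k) := congrFun (congrArg Subtype.val hp) (some k)
    rw [← h1, mul_div_cancel₀ _ hN.ne']
  -- At the fixed point the scaled coordinates are values of `G`, whose fibre sums are at most one;
  -- so `r` does not shrink them.
  have hM1 : ∀ i, M (fun l => N * p.1 (some l)) i = 1 := fun i => by
    apply max_eq_left
    have h1 : ∑ l with a l = i, N * p.1 (some l) = ∑ l with a l = i, f l (r p) +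
        (1 - ∑ l with a l = i, f l (r p)) * ∑ l with a l = i, (r p).1 l := by
      rw [mul_sum, ← sum_add_distrib]
      refine sum_congr rfl fun k hk => ?_
      rw [ht k]
      simp only [G, (mem_filter.1 hk).2]
    have h2 := mul_le_mul_of_nonneg_left ((r p).2.2 i) (sub_nonneg.2 (hs1 (r p) i))
    linarith
  refine ⟨r p, fun k => ?_⟩
  have h1 : (r p).1 k = G k (r p) := by
    rw [← ht k]
    change N * p.1 (some k) / M (fun l => N * p.1 (some l)) (a k) = _
    rw [hM1, div_one]
  simp only [G] at h1
  linarith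

open Finset in
/-- If continuous weights `w k` summing to one are positive only where `y k` lies in the convex
value `B (a k) x`, then one of the correspondences `B i` has a fixed point. -/
theorem exists_mem_of_weights {I : Type u} {E : I → Type v}
    [∀ i, AddCommGroup (E i)] [∀ i, Module ℝ (E i)] [∀ i, TopologicalSpace (E i)]
    [∀ i, IsTopologicalAddGroup (E i)] [∀ i, ContinuousSMul ℝ (E i)]
    {X : ∀ i, Set (E i)} (hX_nonempty : ∀ i, (X i).Nonempty) (hX_convex : ∀ i, Convex ℝ (X i))
    (B : ∀ i, (∀ j, X j) → Set (X i)) (hB_convex : ∀ i x, Convex ℝ ((↑) '' B i x : Set (E i)))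
    {K : Type*} [Fintype K] (a : K → I) (y : ∀ k, X (a k)) (w : K → (∀ j, X j) → ℝ)
    (hw : ∀ k, Continuous (w k)) (hw0 : ∀ k x, 0 ≤ w k x) (hw1 : ∀ x, ∑ k, w k x = 1)
    (hwB : ∀ k x, w k x ≠ 0 → y k ∈ B (a k) x) : ∃ i x, x i ∈ B i x := by
  classical
  choose x₀ hx₀ using hX_nonempty
  let z : ∀ i, K → E i := fun i k => if h : a k = i then h ▸ (y k : E (a k)) else x₀ i
  have hz : ∀ i k, z i k ∈ X i := fun i k => by
    by_cases h : a k = i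
    · subst h; simp [z]
    · simp [z, h, hx₀]
  have hzB : ∀ k x i, a k = i → w k x ≠ 0 → z i k ∈ ((↑) '' B i x : Set (E i)) := by
    rintro k x i rfl h
    exact ⟨y k, hwB k x h, by simp [z]⟩
  let U := {u : K → ℝ // (∀ k, 0 ≤ u k) ∧ ∀ i, ∑ k with a k = i, u k ≤ 1}
  have hmem : ∀ (u : U) i, x₀ i + ∑ k with a k = i, u.1 k • (z i k - x₀ i) ∈ X i := by
    intro u i
    have h1 := (hX_convex i).sum_mem (t := insertNone (univ.filter fun k => a k = i))
      (w := fun o => o.elim (1 - ∑ k with a k = i, u.1 k) u.1)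
      (z := fun o => o.elim (x₀ i) (z i)) ?_ ?_ ?_
    · rw [sum_insertNone] at h1
      convert h1 using 1
      simp only [Option.elim, smul_sub, sum_sub_distrib, sub_smul, one_smul, sum_smul]
      abel
    · rintro (_ | k) -
      · exact sub_nonneg.2 (u.2.2 i)
      · exact u.2.1 k
    · rw [sum_insertNone]
      simp
    · rintro (_ | k) -
      · exact hx₀ i
      · exact hz i k
  -- The mass missing from fibre `j` sits at the base point `x₀ j`; it vanishes for the agent `i`
  -- below, where the fibre sum is one.
  let X' : U → ∀ j, X j := fun u j => ⟨_, hmem u j⟩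
  have hX' : Continuous X' := by
    refine continuous_pi fun j => Continuous.subtype_mk ?_ _
    exact continuous_const.add (continuous_finsetSum _ fun k _ =>
      ((continuous_apply k).comp continuous_subtype_val).smul continuous_const)
  obtain ⟨u, hu⟩ := exists_proportional_on_fibres a (fun k u => w k (X' u))
    (fun k => (hw k).comp hX') (fun k u => hw0 k _) (fun u => (hw1 _).le)
  obtain ⟨k₀, -, hk₀⟩ := exists_ne_zero_of_sum_ne_zero ((hw1 (X' u)).trans_ne one_ne_zero)
  set i := a k₀
  set σ := ∑ l with a l = i, w l (X' u)
  have hσ : 0 < σ := ((hw0 k₀ _).lt_of_ne' hk₀).trans_le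
    (single_le_sum (f := fun l => w l (X' u)) (fun l _ => hw0 l _) (by simp [i]))
  have hui : ∀ k, a k = i → w k (X' u) = σ * u.1 k := fun k hk => by
    rw [hu k, hk]
  have husum : ∑ k with a k = i, u.1 k = 1 := by
    have h1 : σ * ∑ k with a k = i, u.1 k = σ := by
      rw [mul_sum]
      exact sum_congr rfl fun k hk => (hui k (mem_filter.1 hk).2).symm
    exact mul_left_cancel₀ hσ.ne' (h1.trans (mul_one σ).symm)
  have hxi : (X' u i : E i) = ∑ k with a k = i, u.1 k • z i k := by
    change x₀ i + ∑ k with a k = i, u.1 k • (z i k - x₀ i) = _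
    simp only [smul_sub, sum_sub_distrib]
    rw [← sum_smul, husum, one_smul]
    abel
  have hfin : (X' u i : E i) ∈ ((↑) '' B i (X' u) : Set (E i)) := by
    rw [hxi, ← sum_filter_of_ne (p := fun k => w k (X' u) ≠ 0)]
    · refine (hB_convex i _).sum_mem (fun k _ => u.2.1 k) ?_ fun k hk => ?_
      · rw [sum_filter_of_ne, husum]
        intro k hk hne
        rw [hui k (mem_filter.1 hk).2]
        exact mul_ne_zero hσ.ne' hne
      · obtain ⟨hk, hwk⟩ := mem_filter.1 hk
        exact hzB k _ i (mem_filter.1 hk).2 hwk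
    · intro k hk hne hwk
      apply hne
      rw [hui k (mem_filter.1 hk).2] at hwk
      rw [(mul_eq_zero.1 hwk).resolve_left hσ.ne', zero_smul]
  obtain ⟨b, hb, hbx⟩ := hfin
  exact ⟨i, X' u, Subtype.ext hbx ▸ hb⟩

/-- A family of correspondences with convex values and open lower sections on a product of
compact convex sets, none of which has a fixed point, has a common maximal element. -/
theorem exists_forall_eq_empty_of_hasOpenLowerSections {I : Type u} {E : I → Type v}
    [∀ i, AddCommGroup (E i)] [∀ i, Module ℝ (E i)] [∀ i, TopologicalSpace (E i)]
    [∀ i, IsTopologicalAddGroup (E i)] [∀ i, ContinuousSMul ℝ (E i)] [∀ i, T2Space (E i)]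
    {X : ∀ i, Set (E i)} (hX_nonempty : ∀ i, (X i).Nonempty) (hX_compact : ∀ i, IsCompact (X i))
    (hX_convex : ∀ i, Convex ℝ (X i))
    (B : ∀ i, (∀ j, X j) → Set (X i)) (hB_convex : ∀ i x, Convex ℝ ((↑) '' B i x : Set (E i)))
    (hB_lower : ∀ i, HasOpenLowerSections (B i)) (hB_irrefl : ∀ i x, x i ∉ B i x) :
    ∃ x, ∀ i, B i x = ∅ := by
  by_contra! hne
  have : ∀ i, CompactSpace (X i) := fun i => isCompact_iff_compactSpace.1 (hX_compact i)
  obtain ⟨t, ht⟩ := isCompact_univ.elim_finite_subcover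
    (fun p : Σ i, X i => {x : ∀ j, X j | p.2 ∈ B p.1 x})
    (fun p => hasOpenLowerSections_iff_isOpen.1 (hB_lower p.1) p.2) fun x _ => by
      obtain ⟨i, y, hy⟩ := hne x
      exact Set.mem_iUnion.2 ⟨⟨i, y⟩, hy⟩
  obtain ⟨w, hw⟩ := PartitionOfUnity.exists_isSubordinate (isClosed_univ (X := ∀ j, X j))
    (fun p : t => {x : ∀ j, X j | p.1.2 ∈ B p.1.1 x})
    (fun p => hasOpenLowerSections_iff_isOpen.1 (hB_lower p.1.1) p.1.2) fun x hx => by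
      obtain ⟨p, hp, hxp⟩ := Set.mem_iUnion₂.1 (ht hx)
      exact Set.mem_iUnion.2 ⟨⟨p, hp⟩, hxp⟩
  obtain ⟨i, x, hx⟩ := exists_mem_of_weights hX_nonempty hX_convex B hB_convex
    (fun p : t => p.1.1) (fun p => p.1.2) (fun p => w p) (fun p => (w p).continuous)
    (fun p x => w.nonneg p x)
    (fun x => by rw [← finsum_eq_sum_of_fintype]; exact w.sum_eq_one (Set.mem_univ x))
    (fun p x hpx => hw p (subset_tsupport _ hpx))
  exact hB_irrefl i x hx

/-! ### Equilibrium of the abstract economy. -/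

/-- Convex hulls preserve open lower sections. -/
theorem HasOpenLowerSections.isOpen_setOf_mem_convexHull {Y E : Type*} [TopologicalSpace Y]
    [AddCommGroup E] [Module ℝ E] {X : Set E} {P : Y → Set X} (hP : HasOpenLowerSections P)
    (y : E) : IsOpen {x | y ∈ convexHull ℝ ((↑) '' P x : Set E)} := by
  rw [isOpen_iff_mem_nhds]
  intro x hx
  obtain ⟨ι, _, w, z, hw0, hw1, hz, hy⟩ := mem_convexHull_iff_exists_fintype.1 hx
  choose b hb hbz using hz
  -- A convex combination uses finitely many points, hence finitely many open conditions, and the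
  -- same combination works nearby.
  have h1 : ∀ᶠ x' in nhds x, ∀ i, b i ∈ P x' := Filter.eventually_all.2 fun i =>
    (hasOpenLowerSections_iff_isOpen.1 hP (b i)).mem_nhds (hb i)
  filter_upwards [h1] with x' hx'
  exact mem_convexHull_of_exists_fintype w z hw0 hw1 (fun i => ⟨b i, hx' i, hbz i⟩) hy

theorem corollary1 {I : Type u} {E : I → Type v}
    [∀ i, AddCommGroup (E i)] [∀ i, Module ℝ (E i)] [∀ i, TopologicalSpace (E i)]
    [∀ i, IsTopologicalAddGroup (E i)] [∀ i, ContinuousSMul ℝ (E i)] [∀ i, T2Space (E i)]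
    (X : ∀ i, Set (E i))
    (hX_nonempty : ∀ i, (X i).Nonempty)
    (hX_compact : ∀ i, IsCompact (X i))
    (hX_convex : ∀ i, Convex ℝ (X i))
    (Γ : AbstractEconomy I (fun i => X i))
    (hA_convex : ∀ i x, Convex ℝ ((↑) '' Γ.A i x : Set (E i)))
    (hA_nonempty : ∀ i x, (Γ.A i x).Nonempty)
    (hA_usc : ∀ i, UpperHemicontinuous (fun x => closure (Γ.A i x)))
    (hA_lower : ∀ i, HasOpenLowerSections (Γ.A i))
    (hP_lower : ∀ i, HasOpenLowerSections (Γ.P i))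
    (hP_irrefl : ∀ i, ∀ x : (∀ j, X j),
      (x i : E i) ∉ convexHull ℝ ((↑) '' Γ.P i x : Set (E i))) :
    ∃ x, Γ.IsEquilibrium x := by
  let B : ∀ i, (∀ j, X j) → Set (X i) := fun i x => {y | y ∈ Γ.A i x ∧
    (x i ∈ closure (Γ.A i x) → (y : E i) ∈ convexHull ℝ ((↑) '' Γ.P i x : Set (E i)))}
  -- Upper semicontinuity with closed values gives a closed graph. This makes the case where `B i`
  -- is cut down to the hull closed, as open lower sections require.
  have hclosed : ∀ i, IsClosed {x : ∀ j, X j | x i ∈ closure (Γ.A i x)} := fun i =>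
    isClosed_iff_frequently.2 fun x hx =>
      UpperHemicontinuousAt.mem_of_tendsto (hA_usc i x) isClosed_closure Filter.tendsto_id hx
        (continuous_apply i).continuousAt
  have hB_convex : ∀ i x, Convex ℝ ((↑) '' B i x : Set (E i)) := by
    intro i x
    by_cases h : x i ∈ closure (Γ.A i x)
    · have : ((↑) '' B i x : Set (E i)) =
          ((↑) '' Γ.A i x) ∩ convexHull ℝ ((↑) '' Γ.P i x) := by
        ext y
        constructor
        · rintro ⟨b, hb, rfl⟩
          exact ⟨⟨b, hb.1, rfl⟩, hb.2 h⟩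
        · rintro ⟨⟨b, hb, rfl⟩, hy⟩
          exact ⟨b, ⟨hb, fun _ => hy⟩, rfl⟩
      rw [this]
      exact (hA_convex i x).inter (convex_convexHull ℝ _)
    · have : B i x = Γ.A i x := Set.ext fun y =>
        ⟨fun hy => hy.1, fun hy => ⟨hy, fun h' => absurd h' h⟩⟩
      rw [this]
      exact hA_convex i x
  have hB_lower : ∀ i, HasOpenLowerSections (B i) := by
    refine fun i => hasOpenLowerSections_iff_isOpen.2 fun y => ?_
    have : {x | y ∈ B i x} = {x | y ∈ Γ.A i x} ∩ ({x | x i ∈ closure (Γ.A i x)}ᶜ ∪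
        {x | (y : E i) ∈ convexHull ℝ ((↑) '' Γ.P i x : Set (E i))}) :=
      Set.ext fun x => and_congr_right fun _ => imp_iff_not_or
    rw [this]
    exact (hasOpenLowerSections_iff_isOpen.1 (hA_lower i) y).inter
      ((hclosed i).isOpen_compl.union ((hP_lower i).isOpen_setOf_mem_convexHull y))
  obtain ⟨x, hx⟩ := exists_forall_eq_empty_of_hasOpenLowerSections hX_nonempty hX_compact
    hX_convex B hB_convex hB_lower fun i x hx => hP_irrefl i x (hx.2 (subset_closure hx.1))
  refine ⟨x, fun i => ?_⟩
  have hcl : x i ∈ closure (Γ.A i x) := by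
    by_contra h
    obtain ⟨y, hy⟩ := hA_nonempty i x
    exact Set.eq_empty_iff_forall_notMem.1 (hx i) y ⟨hy, fun h' => absurd h' h⟩
  refine ⟨hcl, Set.eq_empty_iff_forall_notMem.2 fun y hy => ?_⟩
  exact Set.eq_empty_iff_forall_notMem.1 (hx i) y
    ⟨hy.1, fun _ => subset_convexHull ℝ _ ⟨y, hy.2, rfl⟩⟩
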